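/- Let $N\ge 1$ be an integer, $H=(H_1,\dots,H_N)\in(0,1)^N$ and $a=(a_1,\dots,a_N)\in\mathbb{R}^N\setminus\{(0,\dots,0)\}$. For $h\in(0,1)$, a fractional Brownian motion on the real line with Hurst parameter $h$ is a centered Gaussian process $(B_t)_{t\in\mathbb{R}}$ with continuous paths and covariance $\operatorname{Cov}(B_t,B_s)=\tfrac12\left(|t|^{2h}+|s|^{2h}-|t-s|^{2h}\right)$, and a sub-fractional Brownian motion with Hurst parameter $h$ is a process of the form $\xi_t=(B_t+B_{-t})/\sqrt2$, $t\ge0$, with $B$ such a fractional Brownian motion. Let $\xi^{1},\dots,\xi^{N}$ be independent sub-fractional Brownian motions on a probability space $(\Omega,\mathcal F,\mathbb P)$ with Hurst parameters $H_1,\dots,H_N$ respectively, and let $S_t=\sum_{i=1}^N a_i\,\xi^{i}_t$, $t\ge 0$, be the mixed sub-fractional Brownian motion with parameters $N,a,H$. Let $i_0\in\{1,\dots,N\}$ be such that $H_{i_0}=\min\{H_i : 1\le i\le N,\ a_i\neq 0\}$. Then, with probability $1$, the graph $\{(t,S_t) : t\in[0,\infty)\}\subset\mathbb{R}^2$ has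 Hausdorff dimension $2-H_{i_0}$. -/

import Mathlib

open MeasureTheory ProbabilityTheory
open scoped NNReal

/-- A fractional Brownian motion on the whole real line with Hurst parameter `H`: a centered
Gaussian process with (almost surely) continuous paths and covariance
`(|t|^(2H) + |s|^(2H) - |t - s|^(2H)) / 2`. -/
structure IsFractionalBM {Ω : Type*} [MeasurableSpace Ω] (H : ℝ) (B : ℝ → Ω → ℝ)
    (P : Measure Ω) : Prop where
  isGaussianProcess : IsGaussianProcess B P
  centered : ∀ t : ℝ, ∫ ω, B t ω ∂P = 0
  covariance_eq : ∀ t s : ℝ,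
    covariance (B t) (B s) P
      = 1 / 2 * (|t| ^ (2 * H) + |s| ^ (2 * H) - |t - s| ^ (2 * H))
  continuous_paths : ∀ᵐ ω ∂P, Continuous fun t : ℝ => B t ω

/-- A sub-fractional Brownian motion with Hurst parameter `H`:
`ξ t = (B t + B (-t)) / √2`, `t ≥ 0`, for a fractional Brownian motion `B` on the real line. -/
def IsSubFractionalBM {Ω : Type*} [MeasurableSpace Ω] (H : ℝ) (ξ : ℝ≥0 → Ω → ℝ)
    (P : Measure Ω) : Prop :=
  ∃ B : ℝ → Ω → ℝ, IsFractionalBM H B P ∧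
    ∀ (t : ℝ≥0) (ω : Ω), ξ t ω = (B (t : ℝ) ω + B (-(t : ℝ)) ω) / √2

/-- A mixed sub-fractional Brownian motion with parameters `N`, `a`, `H`: the process
`S t = ∑ i, a i * ξ i t`, `t ≥ 0`, where the processes `ξ i` are independent sub-fractional
Brownian motions with Hurst parameters `H i`. -/
def IsMixedSubFractionalBM {Ω : Type*} [MeasurableSpace Ω] {N : ℕ} (a H : Fin N → ℝ)
    (S : ℝ≥0 → Ω → ℝ) (P : Measure Ω) : Prop :=
  ∃ ξ : Fin N → ℝ≥0 → Ω → ℝ,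
    (∀ i, IsSubFractionalBM (H i) (ξ i) P) ∧
    iIndepFun (fun (i : Fin N) (ω : Ω) (t : ℝ≥0) => ξ i t ω) P ∧
    ∀ (t : ℝ≥0) (ω : Ω), S t ω = ∑ i, a i * ξ i t ω

/-- The graph `{(t, f t) : t ∈ [0, ∞)}` as a subset of the Euclidean plane. -/
def pathGraph (f : ℝ≥0 → ℝ) : Set (EuclideanSpace ℝ (Fin 2)) :=
  Set.range fun t : ℝ≥0 => !₂[(t : ℝ), f t]

/-!
Write `h` for the smallest Hurst index carried by a nonzero coefficient. The variance of an
increment of a sub-fractional Brownian motion of index `H` is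
`|t - s|^(2H) + (t + s)^(2H) - ((2t)^(2H) + (2s)^(2H)) / 2`, which lies between
`(1 - H) |t - s|^(2H)` and `2 |t - s|^(2H)` for all `t, s ≥ 0`
(`IsSubFractionalBM.le_variance_sub`, `IsSubFractionalBM.variance_sub_le`). By independence, the
increment `S t - S s` of the mixture is a centered Gaussian variable whose variance is bounded below
by a multiple of `|t - s|^(2h)`, and above too when `|t - s| ≤ 1`
(`IsMixedSubFractionalBM.exists_map_sub_eq_gaussianReal`). Only this one-dimensional information and
the continuity of the paths enter the two dimension bounds.

*Upper bound* (`ae_dimH_pathGraph_le`). For `α < h`, Gaussian moments and Borel–Cantelli show that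
eventually all increments over dyadic intervals of length `2^(-n)` in `[0, T]` are at most
`2^(-nα)`; chaining along dyadic approximations bounds the oscillation on each such interval by a multiple of
`2^(-nα)`. Hence the graph over `[0, T)` is covered by `O(2^(n(2 - α)))` squares of side `2^(-n)`,
and its dimension is at most `2 - α` (`dimH_graph_Iio_le`).

*Lower bound* (`ae_le_dimH_pathGraph`). For `1 < σ < 2 - h`, the Gaussian density bound gives
`E |(t, S t) - (s, S s)|^(-σ) ≤ K |t - s|^(1 - σ - h)`, which is integrable over the unit square. So
almost surely Lebesgue measure on `[0, 1]`, transported to the graph, has finite `σ`-energy, and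
the energy method (`le_dimH_of_lintegral_edist_rpow_ne_top`) bounds the dimension below by `σ`.
-/

open Filter Topology Set
open scoped ENNReal

/-! ### Hausdorff dimension from below: the energy method -/

/-- A bound on the `σ`-potential of `μ` at one point of `s` controls the mass of `s`, because `s`
lies in the closed ball of radius `ediam s` about that point. A null or infinite diameter is allowed. -/
theorem measure_le_mul_ediam_rpow {X : Type*} [EMetricSpace X] [MeasurableSpace X]
    [BorelSpace X] {μ : Measure X} {σ : ℝ} {M : ℝ≥0∞} (hM₀ : M ≠ 0) (hM : M ≠ ∞)
    (hσ : 0 < σ) {s : Set X} {x : X} (hx : x ∈ s)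
    (h : ∫⁻ y, edist x y ^ (-σ) ∂μ ≤ M) : μ s ≤ M * Metric.ediam s ^ σ := by
  set d := Metric.ediam s with hd
  have hs : s ⊆ Metric.closedEBall x d := fun y hy => by
    rw [Metric.mem_closedEBall, edist_comm]
    exact Metric.edist_le_ediam_of_mem hx hy
  have hmeas : MeasurableSet (Metric.closedEBall x d) := Metric.isClosed_closedEBall.measurableSet
  have key : d ^ (-σ) * μ s ≤ M := by
    calc d ^ (-σ) * μ s ≤ d ^ (-σ) * μ (Metric.closedEBall x d) := by gcongr
      _ = ∫⁻ y in Metric.closedEBall x d, d ^ (-σ) ∂μ := by simp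
      _ ≤ ∫⁻ y in Metric.closedEBall x d, edist x y ^ (-σ) ∂μ := by
          refine setLIntegral_mono' hmeas fun y hy => ?_
          rw [Metric.mem_closedEBall, edist_comm] at hy
          rw [ENNReal.rpow_neg, ENNReal.rpow_neg, ENNReal.inv_le_inv]
          exact ENNReal.rpow_le_rpow hy hσ.le
      _ ≤ ∫⁻ y, edist x y ^ (-σ) ∂μ := setLIntegral_le_lintegral _ _
      _ ≤ M := h
  rcases eq_or_ne (d ^ σ) 0 with h0 | h0
  · rw [ENNReal.rpow_neg, h0, ENNReal.inv_zero] at key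
    have : μ s = 0 := by
      by_contra hne
      rw [ENNReal.top_mul hne] at key
      exact hM (top_le_iff.1 key)
    simp [this]
  rcases eq_or_ne (d ^ σ) ∞ with h1 | h1
  · rw [h1, ENNReal.mul_top hM₀]; exact le_top
  rw [ENNReal.rpow_neg, mul_comm, ← div_eq_mul_inv] at key
  exact (ENNReal.div_le_iff h0 h1).1 key

/-- **Energy method**: a set charged by a measure of finite `σ`-energy has Hausdorff dimension at
least `σ`. The set need not be measurable. -/
theorem le_dimH_of_lintegral_edist_rpow_ne_top {X : Type*} [EMetricSpace X] [MeasurableSpace X]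
    [BorelSpace X] [SecondCountableTopology X] (μ : Measure X) [SFinite μ] {σ : ℝ≥0} (hσ : 0 < σ)
    {A : Set X} (hA : μ A ≠ 0) (hE : ∫⁻ x, ∫⁻ y, edist x y ^ (-(σ : ℝ)) ∂μ ∂μ ≠ ∞) :
    (σ : ℝ≥0∞) ≤ dimH A := by
  set φ : X → ℝ≥0∞ := fun x => ∫⁻ y, edist x y ^ (-(σ : ℝ)) ∂μ with hφ
  have hmk : Measurable (Function.uncurry fun x y : X => edist x y ^ (-(σ : ℝ))) := by
    have : Measurable fun p : X × X => edist p.1 p.2 := continuous_edist.measurable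
    exact this.pow_const _
  have hφm : Measurable φ := hmk.lintegral_prod_right'
  have hfin : ∀ᵐ x ∂μ, φ x < ∞ := ae_lt_top hφm hE
  obtain ⟨M, hM⟩ : ∃ M : ℕ, μ (A ∩ {x | φ x ≤ M}) ≠ 0 := by
    by_contra! hcon
    apply hA
    have h1 : μ (⋃ M : ℕ, A ∩ {x | φ x ≤ M}) = 0 := measure_iUnion_null hcon
    refine measure_mono_null (t := (⋃ M : ℕ, A ∩ {x | φ x ≤ M}) ∪ {x | ¬ φ x < ∞}) ?_
      (measure_union_null h1 hfin)
    intro x hx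
    by_cases hlt : φ x < ∞
    · left
      obtain ⟨n, hn⟩ := ENNReal.exists_nat_gt hlt.ne
      exact mem_iUnion.2 ⟨n, hx, hn.le⟩
    · exact Or.inr hlt
  have hBm : MeasurableSet {x | φ x ≤ M} := measurableSet_le hφm measurable_const
  -- `M + 1` rather than `M`, so that the normalizing constant is nonzero
  set c : ℝ≥0∞ := (M : ℝ≥0∞) + 1 with hc
  have hc0 : c ≠ 0 := by simp [hc]
  have hct : c ≠ ∞ := by simp [hc]
  have hle : c⁻¹ • μ.restrict {x | φ x ≤ M} ≤ μH[(σ : ℝ)] := by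
    refine Measure.le_hausdorffMeasure _ _ 1 one_pos fun s _ => ?_
    rw [Measure.smul_apply, Measure.restrict_apply' hBm, smul_eq_mul]
    rcases (s ∩ {x | φ x ≤ M}).eq_empty_or_nonempty with h | ⟨x, hxs, hxB⟩
    · simp [h]
    · rw [ENNReal.inv_mul_le_iff hc0 hct]
      refine (measure_mono inter_subset_left).trans ?_
      exact measure_le_mul_ediam_rpow hc0 hct (by exact_mod_cast hσ) hxs
        (le_trans hxB le_self_add)
  apply le_dimH_of_hausdorffMeasure_ne_zero
  intro h0
  have := hle A
  rw [h0, Measure.smul_apply, Measure.restrict_apply' hBm, smul_eq_mul, nonpos_iff_eq_zero,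
    mul_eq_zero] at this
  rcases this with h | h
  · exact hct (ENNReal.inv_eq_zero.1 h)
  · exact hM h

/-! ### Hausdorff dimension of graphs from above: dyadic coverings -/

theorem tendsto_dyadic_floor (t : ℝ≥0) :
    Tendsto (fun n : ℕ => (⌊t * 2 ^ n⌋₊ : ℝ≥0) / 2 ^ n) atTop (𝓝 t) := by
  rw [← NNReal.tendsto_coe]
  have h := (tendsto_nat_floor_mul_div_atTop (R := ℝ) t.coe_nonneg).comp
    (tendsto_pow_atTop_atTop_of_one_lt (one_lt_two : (1 : ℝ) < 2))
  refine h.congr fun n => ?_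
  have : ⌊(t : ℝ) * 2 ^ n⌋₊ = ⌊t * 2 ^ n⌋₊ := by
    refine eq_of_forall_le_iff fun k => ?_
    rw [Nat.le_floor_iff (by positivity), Nat.le_floor_iff zero_le]
    norm_cast
  simp [this]

/-- Chaining: if a continuous function has increments at most `r ^ n` between neighbouring dyadic
points of every level `n ≥ n₀`, then it differs by a geometric tail from its value at the level-`n`
dyadic point to the left. -/
theorem abs_sub_dyadic_floor_le {f : ℝ≥0 → ℝ} (hf : Continuous f) {r : ℝ} (hr₀ : 0 < r)
    (hr₁ : r < 1) {T n₀ : ℕ}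
    (h : ∀ n ≥ n₀, ∀ k < T * 2 ^ n, |f ((k + 1 : ℕ) / 2 ^ n) - f ((k : ℕ) / 2 ^ n)| ≤ r ^ n)
    {n : ℕ} (hn : n₀ ≤ n) {t : ℝ≥0} (ht : t < T) :
    |f t - f ((⌊t * 2 ^ n⌋₊ : ℝ≥0) / 2 ^ n)| ≤ 1 / (1 - r) * r ^ n := by
  set u : ℕ → ℝ := fun m => f ((⌊t * 2 ^ (n + m)⌋₊ : ℝ≥0) / 2 ^ (n + m)) with hu
  have hlim : Tendsto u atTop (𝓝 (f t)) := by
    have h1 := (hf.tendsto t).comp (tendsto_dyadic_floor t)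
    refine (h1.comp (tendsto_add_atTop_nat n)).congr fun m => ?_
    simp [hu, add_comm]
  have hstep : ∀ m, dist (u m) (u (m + 1)) ≤ r ^ n * r ^ m := by
    intro m
    set N := n + m with hN
    set k := ⌊t * 2 ^ N⌋₊ with hk
    have hkT : k < T * 2 ^ N := by
      rw [hk, Nat.floor_lt' (by have := Nat.pos_of_ne_zero (n := T) (by rintro rfl; simp at ht)
                                positivity)]
      push_cast
      gcongr
    have hk1 : (k : ℝ≥0) ≤ t * 2 ^ N := Nat.floor_le (zero_le)
    have hk2 : t * 2 ^ N < k + 1 := Nat.lt_floor_add_one _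
    have hpow : t * 2 ^ (N + 1) = 2 * (t * 2 ^ N) := by ring
    have hcases : ⌊t * 2 ^ (N + 1)⌋₊ = 2 * k ∨ ⌊t * 2 ^ (N + 1)⌋₊ = 2 * k + 1 := by
      have h1 : 2 * k ≤ ⌊t * 2 ^ (N + 1)⌋₊ := by
        apply Nat.le_floor
        rw [hpow]; push_cast; gcongr
      have h2 : ⌊t * 2 ^ (N + 1)⌋₊ < 2 * k + 2 := by
        rw [Nat.floor_lt' (by omega), hpow]
        push_cast
        calc 2 * (t * 2 ^ N) < 2 * (k + 1) := by gcongr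
          _ = 2 * (k : ℝ≥0) + 2 := by ring
      omega
    have hsame : ((2 * k : ℕ) : ℝ≥0) / 2 ^ (N + 1) = (k : ℝ≥0) / 2 ^ N := by
      push_cast; rw [pow_succ']; exact mul_div_mul_left _ _ two_ne_zero
    have hNm : n + (m + 1) = N + 1 := by omega
    have hum : u m = f ((2 * k : ℕ) / 2 ^ (N + 1)) := by rw [hsame]
    have hum' : u (m + 1) = f ((⌊t * 2 ^ (N + 1)⌋₊ : ℝ≥0) / 2 ^ (N + 1)) := by
      simp only [hu, hNm]
    rw [hum, hum']
    rcases hcases with h0 | h0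
    · rw [h0, dist_self]; positivity
    · rw [h0, dist_comm, Real.dist_eq]
      refine (h (N + 1) (by omega) (2 * k) (by rw [pow_succ, ← mul_assoc]; omega)).trans ?_
      rw [← pow_add]
      exact pow_le_pow_of_le_one hr₀.le hr₁.le (by omega)
  have := dist_le_of_le_geometric_of_tendsto₀ r (r ^ n) hr₁ hstep hlim
  rw [dist_comm, Real.dist_eq] at this
  refine this.trans (le_of_eq ?_)
  ring

theorem ediam_square_le {x y δ : ℝ} (hδ : 0 ≤ δ) :
    Metric.ediam {p : EuclideanSpace ℝ (Fin 2) | p 0 ∈ Icc x (x + δ) ∧ p 1 ∈ Icc y (y + δ)}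
      ≤ ENNReal.ofReal (2 * δ) := by
  refine Metric.ediam_le fun p hp q hq => ?_
  rw [edist_dist]
  refine ENNReal.ofReal_le_ofReal ?_
  rw [EuclideanSpace.dist_eq, Fin.sum_univ_two]
  apply Real.sqrt_le_iff.2
  obtain ⟨⟨a1, a2⟩, a3, a4⟩ := hp
  obtain ⟨⟨b1, b2⟩, b3, b4⟩ := hq
  have h0 : dist (p 0) (q 0) ≤ δ := by rw [Real.dist_eq, abs_le]; constructor <;> linarith
  have h1 : dist (p 1) (q 1) ≤ δ := by rw [Real.dist_eq, abs_le]; constructor <;> linarith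
  refine ⟨by positivity, ?_⟩
  calc _ ≤ δ ^ 2 + δ ^ 2 := by gcongr
    _ ≤ (2 * δ) ^ 2 := by nlinarith [sq_nonneg δ]

/-- The graph over `[0, T)` of a continuous function whose dyadic increments of level `n` are at
most `2 ^ (-α n)` has Hausdorff dimension at most `2 - α`: cover it at level `n` by squares of side
`2 ^ (-n)`, about `2 ^ (n (1 - α))` of them above each dyadic interval. -/
theorem dimH_graph_Iio_le {f : ℝ≥0 → ℝ} (hf : Continuous f) {α : ℝ} (hα₀ : 0 < α)
    (hα₁ : α < 1) {T n₀ : ℕ}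
    (h : ∀ n ≥ n₀, ∀ k < T * 2 ^ n,
      |f ((k + 1 : ℕ) / 2 ^ n) - f ((k : ℕ) / 2 ^ n)| ≤ ((2 : ℝ) ^ (-α)) ^ n) :
    dimH ((fun t : ℝ≥0 => (!₂[(t : ℝ), f t] : EuclideanSpace ℝ (Fin 2))) '' Iio (T : ℝ≥0))
      ≤ ENNReal.ofReal (2 - α) := by
  set r : ℝ := (2 : ℝ) ^ (-α) with hr
  have hr₀ : 0 < r := by positivity
  have hr₁ : r < 1 := Real.rpow_lt_one_of_one_lt_of_neg one_lt_two (by linarith)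
  have h2r : 1 ≤ 2 * r := by
    rw [hr, ← Real.rpow_one_add' (by norm_num) (by linarith)]
    exact Real.one_le_rpow one_le_two (by linarith)
  set C : ℝ := 1 / (1 - r) with hC
  have hC₀ : 0 < C := by rw [hC]; apply one_div_pos.2; linarith
  set d : ℝ := 2 - α with hd
  have hd₀ : 0 < d := by linarith
  -- this identity makes the covering sums bounded: `2 ^ n * (2 * r) ^ n * 2 ^ (-n * d) = 1`
  have h2d : (2 : ℝ) ^ d = 4 * r := by
    rw [hd, hr, sub_eq_add_neg, Real.rpow_add two_pos]; norm_num
  have hdyad := fun n (hn : n₀ ≤ n) t (ht : t < (T : ℝ≥0)) =>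
    abs_sub_dyadic_floor_le hf hr₀ hr₁ h hn ht
  set K : ℕ → ℕ := fun n => ⌊2 * C * (2 * r) ^ n⌋₊ + 1 with hK
  set Q : ∀ n : ℕ, Fin (T * 2 ^ n) × Fin (K n) → Set (EuclideanSpace ℝ (Fin 2)) := fun n i =>
    {p | p 0 ∈ Icc ((i.1 : ℝ) / 2 ^ n) ((i.1 : ℝ) / 2 ^ n + 1 / 2 ^ n) ∧
      p 1 ∈ Icc (f ((i.1 : ℕ) / 2 ^ n) - C * r ^ n + (i.2 : ℝ) / 2 ^ n)
        (f ((i.1 : ℕ) / 2 ^ n) - C * r ^ n + (i.2 : ℝ) / 2 ^ n + 1 / 2 ^ n)} with hQ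
  have hdiam : ∀ n i, Metric.ediam (Q n i) ≤ ENNReal.ofReal (2 * (1 / 2 ^ n)) := fun n i =>
    ediam_square_le (by positivity)
  have hμ : μH[d] ((fun t : ℝ≥0 => (!₂[(t : ℝ), f t] : EuclideanSpace ℝ (Fin 2))) ''
      Iio (T : ℝ≥0)) ≤ ENNReal.ofReal (T * (2 * C + 1) * 2 ^ d) := by
    refine (Measure.hausdorffMeasure_le_liminf_sum d _ (l := atTop)
      (fun n : ℕ => ENNReal.ofReal (2 * (1 / 2 ^ n))) ?_ Q (Eventually.of_forall hdiam) ?_).trans ?_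
    · rw [← ENNReal.ofReal_zero]
      refine ENNReal.tendsto_ofReal ?_
      have := (tendsto_pow_atTop_nhds_zero_of_lt_one (r := (1 / 2 : ℝ)) (by norm_num)
        (by norm_num)).const_mul 2
      simpa [one_div, inv_pow] using this
    · filter_upwards [eventually_ge_atTop n₀] with n hn
      rintro _ ⟨t, ht, rfl⟩
      have ht : t < (T : ℝ≥0) := ht
      have h2n : (0 : ℝ) < 2 ^ n := by positivity
      have hab := abs_le.1 (hdyad n hn t ht)
      set k := ⌊t * 2 ^ n⌋₊ with hk
      have hkT : k < T * 2 ^ n := by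
        rw [hk, Nat.floor_lt' (by have := Nat.pos_of_ne_zero (n := T) (by rintro rfl; simp at ht)
                                  positivity)]
        push_cast
        gcongr
      have hk1' : (k : ℝ≥0) ≤ t * 2 ^ n := Nat.floor_le zero_le
      have hk2' : t * 2 ^ n < (k : ℝ≥0) + 1 := Nat.lt_floor_add_one _
      have hk1 : (k : ℝ) ≤ t * 2 ^ n := by exact_mod_cast hk1'
      have hk2 : (t : ℝ) * 2 ^ n < k + 1 := by exact_mod_cast hk2'
      set y : ℝ := f t - f ((k : ℕ) / 2 ^ n) + C * r ^ n with hy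
      have hy0 : 0 ≤ y * 2 ^ n := mul_nonneg (by linarith [hab.1]) h2n.le
      have hjK : ⌊y * 2 ^ n⌋₊ < K n := by
        rw [hK, Nat.lt_add_one_iff]
        apply Nat.floor_le_floor
        calc y * 2 ^ n ≤ (2 * C * r ^ n) * 2 ^ n := by gcongr; linarith [hab.2]
          _ = _ := by rw [mul_pow]; ring
      have hj1 := Nat.floor_le hy0
      have hj2 := Nat.lt_floor_add_one (y * 2 ^ n)
      refine mem_iUnion.2 ⟨(⟨k, hkT⟩, ⟨⌊y * 2 ^ n⌋₊, hjK⟩), ?_⟩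
      simp only [hQ, mem_ofPred_eq, mem_Icc, ← add_div]
      simp only [Matrix.cons_val_zero, Matrix.cons_val_one]
      refine ⟨⟨?_, ?_⟩, ?_, ?_⟩
      · rw [div_le_iff₀ h2n]; exact hk1
      · rw [le_div_iff₀ h2n]; exact hk2.le
      · have : (⌊y * 2 ^ n⌋₊ : ℝ) / 2 ^ n ≤ y := by rw [div_le_iff₀ h2n]; exact hj1
        linarith
      · have : y ≤ ((⌊y * 2 ^ n⌋₊ : ℝ) + 1) / 2 ^ n := by rw [le_div_iff₀ h2n]; exact hj2.le
        rw [add_div] at this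
        linarith
    · refine (liminf_le_liminf (v := fun _ : ℕ => ENNReal.ofReal (T * (2 * C + 1) * 2 ^ d))
        (Eventually.of_forall fun n => ?_)).trans (by simp)
      have hterm : ∀ i, Metric.ediam (Q n i) ^ d ≤ ENNReal.ofReal ((2 * (1 / 2 ^ n)) ^ d) :=
        fun i => by
          rw [← ENNReal.ofReal_rpow_of_pos (by positivity)]
          exact ENNReal.rpow_le_rpow (hdiam n i) hd₀.le
      refine (Finset.sum_le_sum fun i _ => hterm i).trans ?_
      rw [Finset.sum_const, Finset.card_univ, Fintype.card_prod, Fintype.card_fin, Fintype.card_fin,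
        nsmul_eq_mul, ← ENNReal.ofReal_natCast, ← ENNReal.ofReal_mul (by positivity)]
      refine ENNReal.ofReal_le_ofReal ?_
      have hone : (1 : ℝ) ≤ (2 * r) ^ n := one_le_pow₀ h2r
      have hKn : (K n : ℝ) ≤ (2 * C + 1) * (2 * r) ^ n := by
        have := Nat.floor_le (a := 2 * C * (2 * r) ^ n) (by positivity)
        simp only [hK]; push_cast; linarith
      have hpow : (2 * (1 / 2 ^ n) : ℝ) ^ d = 2 ^ d / (4 * r) ^ n := by
        rw [mul_one_div, Real.div_rpow (by norm_num) (by positivity), ← Real.rpow_natCast 2 n,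
          ← Real.rpow_mul (by norm_num), mul_comm (n : ℝ) d, Real.rpow_mul (by norm_num), h2d,
          Real.rpow_natCast]
      rw [hpow]
      push_cast
      have hpos : (0 : ℝ) < (4 * r) ^ n := by positivity
      rw [← mul_div_assoc, div_le_iff₀ hpos]
      calc (T : ℝ) * 2 ^ n * K n * 2 ^ d
          ≤ T * 2 ^ n * ((2 * C + 1) * (2 * r) ^ n) * 2 ^ d := by gcongr
        _ = T * (2 * C + 1) * 2 ^ d * (4 * r) ^ n := by
          rw [show (4 * r) ^ n = 2 ^ n * (2 * r) ^ n by rw [← mul_pow]; ring]; ring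
  have := dimH_le_of_hausdorffMeasure_ne_top (d := d.toNNReal)
    (s := (fun t : ℝ≥0 => (!₂[(t : ℝ), f t] : EuclideanSpace ℝ (Fin 2))) '' Iio (T : ℝ≥0)) (by
      rw [Real.coe_toNNReal _ hd₀.le]
      exact (hμ.trans_lt ENNReal.ofReal_lt_top).ne)
  exact this

/-! ### Increments of sub-fractional Brownian motions -/

/-- Bernoulli's inequality with exponent `p / 2 ≤ 1`, applied to `(1 + u) ^ 2`. -/
theorem rpow_one_add_le_quadratic {p u : ℝ} (hp₀ : 0 ≤ p) (hp₂ : p ≤ 2) (hu : -1 ≤ u) :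
    (1 + u) ^ p ≤ 1 + p / 2 * (2 * u + u ^ 2) := by
  have h := rpow_one_add_le_one_add_mul_self (s := 2 * u + u ^ 2) (by nlinarith [sq_nonneg (1 + u)])
    (p := p / 2) (by linarith) (by linarith)
  rw [show 1 + (2 * u + u ^ 2) = (1 + u) ^ 2 by ring, ← Real.rpow_natCast,
    ← Real.rpow_mul (by linarith)] at h
  convert! h using 2
  push_cast; ring

/-- Upper bound for the mean of `x ^ p` over a symmetric pair, responsible for the nondegeneracy of
the increments: the constant `p / 2` is smaller than `1` when `p = 2 * H` with `H < 1`. -/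
theorem half_sum_rpow_le {p x y : ℝ} (hp₀ : 0 < p) (hp₂ : p ≤ 2) (hxy : |y| ≤ x) :
    ((x + y) ^ p + (x - y) ^ p) / 2 ≤ x ^ p + p / 2 * |y| ^ p := by
  rcases (abs_nonneg y).trans hxy |>.eq_or_lt with h0 | hx
  · have : y = 0 := by rw [← h0] at hxy; exact abs_nonpos_iff.1 hxy
    subst h0; subst this
    simp [Real.zero_rpow hp₀.ne']
  set u := y / x with hu
  have hyu : y = x * u := by rw [hu]; field_simp
  have hu1 : |u| ≤ 1 := by rw [hu, abs_div, abs_of_pos hx]; exact (div_le_one hx).2 hxy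
  obtain ⟨hl, hr⟩ := abs_le.1 hu1
  have h1 := rpow_one_add_le_quadratic hp₀.le hp₂ hl
  have h2 := rpow_one_add_le_quadratic (u := -u) hp₀.le hp₂ (by linarith)
  have hsq : u ^ 2 ≤ |u| ^ p := by
    rw [← sq_abs, ← Real.rpow_natCast]
    exact Real.rpow_le_rpow_of_exponent_ge_of_imp (abs_nonneg u) hu1 (by exact_mod_cast hp₂)
      (by simp)
  have hxp : 0 < x ^ p := by positivity
  have e1 : (x + y) ^ p = x ^ p * (1 + u) ^ p := by
    rw [← Real.mul_rpow hx.le (by linarith), hyu]; ring_nf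
  have e2 : (x - y) ^ p = x ^ p * (1 + -u) ^ p := by
    rw [← Real.mul_rpow hx.le (by linarith), hyu]; ring_nf
  have e3 : |y| ^ p = x ^ p * |u| ^ p := by
    rw [← Real.mul_rpow hx.le (abs_nonneg _), hyu, abs_mul, abs_of_pos hx]
  rw [e1, e2, e3]
  have : ((1 + u) ^ p + (1 + -u) ^ p) / 2 ≤ 1 + p / 2 * |u| ^ p := by
    have : p / 2 * u ^ 2 ≤ p / 2 * |u| ^ p := by gcongr
    linarith
  calc _ = x ^ p * (((1 + u) ^ p + (1 + -u) ^ p) / 2) := by ring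
    _ ≤ x ^ p * (1 + p / 2 * |u| ^ p) := by gcongr
    _ = _ := by ring

theorem rpow_le_half_sum_add {p x y : ℝ} (hp₀ : 0 < p) (hxy : |y| ≤ x) :
    x ^ p ≤ ((x + y) ^ p + (x - y) ^ p) / 2 + |y| ^ p := by
  wlog hy : 0 ≤ y generalizing y
  · have := this (y := -y) (by rwa [abs_neg]) (by linarith)
    rw [abs_neg] at this
    convert! this using 2
    ring_nf
  rw [abs_of_nonneg hy] at hxy ⊢
  have hx : 0 ≤ x := hy.trans hxy
  rcases le_total p 1 with h | h
  · have h1 := Real.rpow_add_le_add_rpow (sub_nonneg.2 hxy) hy hp₀.le h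
    rw [sub_add_cancel] at h1
    have h2 : x ^ p ≤ (x + y) ^ p := Real.rpow_le_rpow hx (by linarith) hp₀.le
    have : 0 ≤ y ^ p := Real.rpow_nonneg hy _
    linarith
  · have hconv := (convexOn_rpow h).2 (mem_Ici.2 (by linarith : 0 ≤ x + y))
      (mem_Ici.2 (sub_nonneg.2 hxy)) (by norm_num : (0 : ℝ) ≤ 1 / 2)
      (by norm_num : (0 : ℝ) ≤ 1 / 2) (by norm_num)
    simp only [smul_eq_mul] at hconv
    rw [show 1 / 2 * (x + y) + 1 / 2 * (x - y) = x by ring] at hconv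
    have : 0 ≤ y ^ p := Real.rpow_nonneg hy _
    linarith

section

variable {Ω : Type*} [MeasurableSpace Ω] {P : Measure Ω}

theorem IsSubFractionalBM.hasGaussianLaw_sub {H : ℝ} {ξ : ℝ≥0 → Ω → ℝ}
    (hξ : IsSubFractionalBM H ξ P) (t s : ℝ≥0) :
    HasGaussianLaw (fun ω => ξ t ω - ξ s ω) P := by
  obtain ⟨B, hB, hξB⟩ := hξ
  set I : Finset ℝ := {(t : ℝ), -(t : ℝ), (s : ℝ), -(s : ℝ)} with hI
  have hI' := hB.isGaussianProcess.hasGaussianLaw I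
  let e (x : ℝ) (hx : x ∈ I) : (I → ℝ) →L[ℝ] ℝ := ContinuousLinearMap.proj (R := ℝ) ⟨x, hx⟩
  let L : (I → ℝ) →L[ℝ] ℝ := (√2)⁻¹ •
    (e t (by simp [hI]) + e (-t) (by simp [hI]) - e s (by simp [hI]) - e (-s) (by simp [hI]))
  have := hI'.map_fun L
  convert! this using 2 with ω
  simp only [hξB, L, e, smul_apply, sub_apply,
    add_apply, ContinuousLinearMap.proj_apply, smul_eq_mul, Finset.restrict]
  ring

theorem IsFractionalBM.memLp {H : ℝ} {B : ℝ → Ω → ℝ} (hB : IsFractionalBM H B P) (t : ℝ) :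
    MemLp (B t) 2 P := (hB.isGaussianProcess.hasGaussianLaw_eval t).memLp_two

theorem IsSubFractionalBM.integral_sub [IsProbabilityMeasure P] {H : ℝ} {ξ : ℝ≥0 → Ω → ℝ}
    (hξ : IsSubFractionalBM H ξ P) (t s : ℝ≥0) : ∫ ω, (ξ t ω - ξ s ω) ∂P = 0 := by
  obtain ⟨B, hB, hξB⟩ := hξ
  have hint : ∀ x, Integrable (B x) P := fun x => (hB.memLp x).integrable one_le_two
  have : ∀ t : ℝ≥0, ∫ ω, ξ t ω ∂P = 0 := fun t => by
    simp_rw [hξB]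
    rw [integral_div, integral_add (hint _) (hint _), hB.centered, hB.centered]; simp
  have hi : ∀ t : ℝ≥0, Integrable (ξ t) P := fun t => by
    have : ξ t = fun ω => (B t ω + B (-t) ω) / √2 := funext (hξB t)
    rw [this]
    exact ((hint _).add (hint _)).div_const _
  rw [MeasureTheory.integral_sub (hi t) (hi s), this, this, sub_zero]

/-- The variance of an increment; `2t` and `2s` are written as `(t + s) ± (t - s)`, the form in
which `half_sum_rpow_le` and `rpow_le_half_sum_add` apply. -/
theorem IsSubFractionalBM.variance_sub [IsProbabilityMeasure P] {H : ℝ} {ξ : ℝ≥0 → Ω → ℝ}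
    (hH : 0 < H) (hξ : IsSubFractionalBM H ξ P) (t s : ℝ≥0) :
    Var[fun ω => ξ t ω - ξ s ω; P] = |(t : ℝ) - s| ^ (2 * H) + (t + s : ℝ) ^ (2 * H)
      - ((t + s + (t - s) : ℝ) ^ (2 * H) + (t + s - (t - s) : ℝ) ^ (2 * H)) / 2 := by
  obtain ⟨B, hB, hξB⟩ := hξ
  have hm := hB.memLp
  have he : (fun ω => ξ t ω - ξ s ω)
      = (√2)⁻¹ • ((B t + B (-t)) - (B s + B (-s))) := by
    ext ω
    simp only [hξB, Pi.smul_apply, Pi.sub_apply, Pi.add_apply, smul_eq_mul]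
    ring
  have hT : MemLp (B t + B (-t)) 2 P := (hm _).add (hm _)
  have hS : MemLp (B s + B (-s)) 2 P := (hm _).add (hm _)
  have hcov : ∀ x y : ℝ, 0 ≤ x → 0 ≤ y → cov[B x + B (-x), B y + B (-y); P]
      = 2 * x ^ (2 * H) + 2 * y ^ (2 * H) - |x - y| ^ (2 * H) - (x + y) ^ (2 * H) := by
    intro x y hx hy
    rw [covariance_add_left (hm _) (hm _) ((hm _).add (hm _)),
      covariance_add_right (hm _) (hm _) (hm _), covariance_add_right (hm _) (hm _) (hm _),
      hB.covariance_eq, hB.covariance_eq, hB.covariance_eq, hB.covariance_eq]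
    rw [show -x - y = -(x + y) by ring, show -x - -y = -(x - y) by ring, sub_neg_eq_add]
    simp only [abs_neg]
    rw [abs_of_nonneg hx, abs_of_nonneg hy, abs_of_nonneg (add_nonneg hx hy)]
    ring
  rw [he, variance_smul, ← covariance_self (hT.sub hS).aemeasurable,
    covariance_sub_left hT hS (hT.sub hS), covariance_sub_right hT hT hS,
    covariance_sub_right hS hT hS,
    hcov _ _ t.coe_nonneg t.coe_nonneg, hcov _ _ t.coe_nonneg s.coe_nonneg,
    hcov _ _ s.coe_nonneg t.coe_nonneg, hcov _ _ s.coe_nonneg s.coe_nonneg, inv_pow,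
    Real.sq_sqrt zero_le_two, abs_sub_comm (s : ℝ) t, add_comm (s : ℝ) t, sub_self, sub_self,
    abs_zero, Real.zero_rpow (by positivity)]
  rw [show (t + s + (t - s) : ℝ) = t + t by ring, show (t + s - (t - s) : ℝ) = s + s by ring]
  ring

theorem abs_coe_sub_le_add (t s : ℝ≥0) : |(t : ℝ) - s| ≤ t + s := by
  rw [abs_le]; constructor <;> linarith [t.coe_nonneg, s.coe_nonneg]

theorem IsSubFractionalBM.le_variance_sub [IsProbabilityMeasure P] {H : ℝ} {ξ : ℝ≥0 → Ω → ℝ}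
    (hH : H ∈ Ioo (0 : ℝ) 1) (hξ : IsSubFractionalBM H ξ P) (t s : ℝ≥0) :
    (1 - H) * |(t : ℝ) - s| ^ (2 * H) ≤ Var[fun ω => ξ t ω - ξ s ω; P] := by
  rw [hξ.variance_sub hH.1]
  have := half_sum_rpow_le (p := 2 * H) (by linarith [hH.1]) (by linarith [hH.2])
    (abs_coe_sub_le_add t s)
  linarith

theorem IsSubFractionalBM.variance_sub_le [IsProbabilityMeasure P] {H : ℝ} {ξ : ℝ≥0 → Ω → ℝ}
    (hH : H ∈ Ioo (0 : ℝ) 1) (hξ : IsSubFractionalBM H ξ P) (t s : ℝ≥0) :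
    Var[fun ω => ξ t ω - ξ s ω; P] ≤ 2 * |(t : ℝ) - s| ^ (2 * H) := by
  rw [hξ.variance_sub hH.1]
  have := rpow_le_half_sum_add (p := 2 * H) (by linarith [hH.1]) (abs_coe_sub_le_add t s)
  linarith

/-- The increments of a mixed sub-fractional Brownian motion are centered Gaussian. The component
with the smallest index gives the lower variance bound; on the scale `|t - s| ≤ 1` every other
component is dominated by it. -/
theorem IsMixedSubFractionalBM.exists_map_sub_eq_gaussianReal [IsProbabilityMeasure P]
    {N : ℕ} {a H : Fin N → ℝ}
    (hH : ∀ i, H i ∈ Ioo (0 : ℝ) 1) {S : ℝ≥0 → Ω → ℝ} (hS : IsMixedSubFractionalBM a H S P)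
    {i₀ : Fin N} (hi₀ : IsLeast {h : ℝ | ∃ i, a i ≠ 0 ∧ h = H i} (H i₀)) :
    ∃ c C : ℝ, 0 < c ∧ 0 < C ∧ ∀ t s : ℝ≥0, ∃ v : ℝ≥0,
      P.map (fun ω => S t ω - S s ω) = gaussianReal 0 v ∧
      c * |(t : ℝ) - s| ^ (2 * H i₀) ≤ v ∧
      (|(t : ℝ) - s| ≤ 1 → v ≤ C * |(t : ℝ) - s| ^ (2 * H i₀)) := by
  obtain ⟨ξ, hξ, hind, hSξ⟩ := hS
  obtain ⟨i₁, hai₁, hHi₁⟩ := hi₀.1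
  refine ⟨a i₁ ^ 2 * (1 - H i₁), ∑ i, a i ^ 2 * 2, ?_, ?_, fun t s => ?_⟩
  · have := (hH i₁).2
    have : 0 < 1 - H i₁ := by linarith
    positivity
  · refine Finset.sum_pos' (fun i _ => by positivity) ⟨i₁, Finset.mem_univ _, by positivity⟩
  set X : Fin N → Ω → ℝ := fun i ω => a i * (ξ i t ω - ξ i s ω) with hX
  have hSX : (fun ω => S t ω - S s ω) = fun ω => ∑ i, X i ω := by
    ext ω
    simp only [hSξ, hX, ← Finset.sum_sub_distrib, mul_sub]
  have hXg : ∀ i, HasGaussianLaw (X i) P := fun i => by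
    have := ((hξ i).hasGaussianLaw_sub t s).fun_smul (a i)
    simpa only [smul_eq_mul] using this
  have hXind : iIndepFun X P := by
    refine hind.comp (fun i (f : ℝ≥0 → ℝ) => a i * (f t - f s)) fun i => ?_
    fun_prop
  have hg := hXind.hasGaussianLaw_fun_sum hXg
  have hmean : ∫ ω, ∑ i, X i ω ∂P = 0 := by
    rw [integral_finsetSum _ fun i _ => (hXg i).integrable]
    refine Finset.sum_eq_zero fun i _ => ?_
    rw [integral_const_mul, (hξ i).integral_sub, mul_zero]
  have hvar : Var[fun ω => ∑ i, X i ω; P]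
      = ∑ i, a i ^ 2 * Var[fun ω => ξ i t ω - ξ i s ω; P] := by
    have := IndepFun.variance_sum (s := Finset.univ) (X := X) (μ := P)
      (fun i _ => (hXg i).memLp_two) (fun i _ j _ hij => hXind.indepFun hij)
    rw [show (fun ω => ∑ i, X i ω) = ∑ i, X i by ext; simp, this]
    exact Finset.sum_congr rfl fun i _ => variance_const_mul _ _ _
  refine ⟨(Var[fun ω => ∑ i, X i ω; P]).toNNReal, ?_, ?_, ?_⟩
  · rw [hSX, hg.map_eq_gaussianReal, hmean]
  · rw [Real.coe_toNNReal _ (variance_nonneg _ _), hvar, hHi₁, mul_assoc]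
    refine le_trans (mul_le_mul_of_nonneg_left ((hξ i₁).le_variance_sub (hH i₁) t s)
      (sq_nonneg _)) ?_
    exact Finset.single_le_sum (f := fun i => a i ^ 2 * Var[fun ω => ξ i t ω - ξ i s ω; P])
      (fun i _ => mul_nonneg (sq_nonneg _) (variance_nonneg _ _)) (Finset.mem_univ i₁)
  · intro hts
    rw [Real.coe_toNNReal _ (variance_nonneg _ _), hvar, Finset.sum_mul]
    refine Finset.sum_le_sum fun i _ => ?_
    by_cases hai : a i = 0
    · simp [hai]
    rw [mul_assoc]
    refine mul_le_mul_of_nonneg_left (((hξ i).variance_sub_le (hH i) t s).trans ?_) (sq_nonneg _)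
    have hle : H i₀ ≤ H i := hi₀.2 ⟨i, hai, rfl⟩
    refine mul_le_mul_of_nonneg_left ?_ zero_le_two
    exact Real.rpow_le_rpow_of_exponent_ge_of_imp (abs_nonneg _) hts (by linarith)
      (by intro _ h; linarith [(hH i₀).1])

end

/-! ### Almost sure path properties and the upper bound -/

/-- Markov's inequality for the `q`-th absolute moment of a centered Gaussian law. -/
theorem exists_gaussianReal_tail_le (q : ℕ) :
    ∃ K : ℝ, 0 ≤ K ∧ ∀ (v : ℝ≥0) (l : ℝ), 0 < l →
      gaussianReal 0 v {x | l < |x|} ≤ ENNReal.ofReal (K * (√v / l) ^ q) := by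
  have hint : Integrable (fun z : ℝ => |z| ^ q) (gaussianReal 0 1) := by
    have := (memLp_id_gaussianReal (μ := 0) (v := 1) (q : ℝ≥0)).integrable_norm_pow'
    simpa using this
  refine ⟨∫ z, |z| ^ q ∂gaussianReal 0 1, integral_nonneg fun z => by positivity,
    fun v l hl => ?_⟩
  have hmap : gaussianReal 0 v = (gaussianReal 0 1).map (√v * ·) := by
    rw [gaussianReal_map_const_mul]
    congr 1
    · simp
    · ext; simp
  rw [hmap, Measure.map_apply (by fun_prop) (measurableSet_lt measurable_const (by fun_prop)),
    mul_comm, ← integral_const_mul, ofReal_integral_eq_lintegral_ofReal (hint.const_mul _)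
      (ae_of_all _ fun z => by positivity)]
  have hmarkov := meas_ge_le_lintegral_div (μ := gaussianReal 0 1)
    (f := fun z : ℝ => ENNReal.ofReal ((√v / l) ^ q * |z| ^ q)) (by fun_prop) one_ne_zero
    ENNReal.one_ne_top
  rw [div_one] at hmarkov
  refine le_trans ?_ hmarkov
  refine measure_mono fun z hz => ?_
  have hz : l < |√v * z| := hz
  rw [abs_mul, abs_of_nonneg (Real.sqrt_nonneg _)] at hz
  change 1 ≤ ENNReal.ofReal _
  rw [ENNReal.one_le_ofReal, ← mul_pow]
  refine one_le_pow₀ ?_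
  rw [div_mul_eq_mul_div, one_le_div hl]
  exact hz.le

section

variable {Ω : Type*} [MeasurableSpace Ω] {P : Measure Ω}

/-- The Borel–Cantelli step of the Kolmogorov–Chentsov argument. -/
theorem ae_eventually_dyadic_increments_le [IsProbabilityMeasure P] {S : ℝ≥0 → Ω → ℝ} {C h : ℝ}
    (hC : 0 ≤ C)
    (hlaw : ∀ t s : ℝ≥0, |(t : ℝ) - s| ≤ 1 → ∃ v : ℝ≥0,
      P.map (fun ω => S t ω - S s ω) = gaussianReal 0 v ∧ v ≤ C * |(t : ℝ) - s| ^ (2 * h))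
    {α : ℝ} (hα : α < h) (T : ℕ) :
    ∀ᵐ ω ∂P, ∀ᶠ n : ℕ in atTop, ∀ k < T * 2 ^ n,
      |S ((k + 1 : ℕ) / 2 ^ n) ω - S ((k : ℕ) / 2 ^ n) ω| ≤ ((2 : ℝ) ^ (-α)) ^ n := by
  set ρ : ℝ := 2 ^ (α - h) with hρ
  have hρ₀ : 0 < ρ := by positivity
  have hρ₁ : ρ < 1 := Real.rpow_lt_one_of_one_lt_of_neg one_lt_two (by linarith)
  -- a moment so high that the failure probability `4 ^ (-n)` beats the `T * 2 ^ n` intervals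
  obtain ⟨q, hq⟩ := exists_pow_lt_of_lt_one (show (0 : ℝ) < 1 / 4 by norm_num) hρ₁
  obtain ⟨K, hK₀, hK⟩ := exists_gaussianReal_tail_le q
  set D : ℝ := K * √C ^ q with hD
  have hD₀ : 0 ≤ D := by positivity
  have hbad : ∀ n k : ℕ, P {ω | ((2 : ℝ) ^ (-α)) ^ n <
      |S ((k + 1 : ℕ) / 2 ^ n) ω - S ((k : ℕ) / 2 ^ n) ω|} ≤ ENNReal.ofReal (D * (1 / 4) ^ n) := by
    intro n k
    have h2n : (0 : ℝ) < 2 ^ n := by positivity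
    have hdist : |(((k + 1 : ℕ) / 2 ^ n : ℝ≥0) : ℝ) - ((k / 2 ^ n : ℝ≥0) : ℝ)| = 1 / 2 ^ n := by
      push_cast
      rw [← sub_div, add_sub_cancel_left, abs_of_pos (by positivity)]
    obtain ⟨v, hv, hvC⟩ := hlaw ((k + 1 : ℕ) / 2 ^ n) (k / 2 ^ n) (by
      rw [hdist, div_le_one h2n]; exact one_le_pow₀ one_le_two)
    have hae : AEMeasurable (fun ω => S ((k + 1 : ℕ) / 2 ^ n) ω - S ((k : ℕ) / 2 ^ n) ω) P :=
      AEMeasurable.of_map_ne_zero (by rw [hv]; exact NeZero.ne _)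
    have htail := hK v (((2 : ℝ) ^ (-α)) ^ n) (by positivity)
    rw [← hv, Measure.map_apply_of_aemeasurable hae
      (measurableSet_lt measurable_const (by fun_prop))] at htail
    refine htail.trans (ENNReal.ofReal_le_ofReal ?_)
    have hsv : √v ≤ √C * ((2 : ℝ) ^ (-h)) ^ n := by
      rw [hdist] at hvC
      apply Real.sqrt_le_iff.2 ⟨by positivity, hvC.trans (le_of_eq ?_)⟩
      rw [mul_pow, Real.sq_sqrt hC, one_div, ← Real.rpow_natCast 2 n, ← Real.rpow_neg zero_le_two,
        ← Real.rpow_mul zero_le_two, ← pow_mul, ← Real.rpow_natCast, ← Real.rpow_mul zero_le_two]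
      congr 2
      push_cast; ring
    have hratio : √v / ((2 : ℝ) ^ (-α)) ^ n ≤ √C * ρ ^ n := by
      rw [div_le_iff₀ (by positivity), mul_assoc, ← mul_pow, hρ, ← Real.rpow_add two_pos]
      rwa [show α - h + -α = -h by ring]
    calc K * (√v / ((2 : ℝ) ^ (-α)) ^ n) ^ q ≤ K * (√C * ρ ^ n) ^ q := by gcongr
      _ = D * (ρ ^ q) ^ n := by rw [mul_pow, hD, ← pow_mul, ← pow_mul, mul_comm n q]; ring
      _ ≤ D * (1 / 4) ^ n := by gcongr
  have hsum : ∑' n : ℕ, P (⋃ k ∈ Finset.range (T * 2 ^ n), {ω | ((2 : ℝ) ^ (-α)) ^ n <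
      |S ((k + 1 : ℕ) / 2 ^ n) ω - S ((k : ℕ) / 2 ^ n) ω|}) ≠ ∞ := by
    have hle : ∀ n : ℕ, P (⋃ k ∈ Finset.range (T * 2 ^ n), {ω | ((2 : ℝ) ^ (-α)) ^ n <
        |S ((k + 1 : ℕ) / 2 ^ n) ω - S ((k : ℕ) / 2 ^ n) ω|})
        ≤ ENNReal.ofReal (T * D * (1 / 2) ^ n) := by
      intro n
      refine (measure_biUnion_finset_le _ _).trans ?_
      refine (Finset.sum_le_sum fun k _ => hbad n k).trans ?_
      rw [Finset.sum_const, Finset.card_range, nsmul_eq_mul, ← ENNReal.ofReal_natCast,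
        ← ENNReal.ofReal_mul (by positivity)]
      refine ENNReal.ofReal_le_ofReal (le_of_eq ?_)
      push_cast
      rw [show (1 / 2 : ℝ) ^ n = 2 ^ n * (1 / 4) ^ n by rw [← mul_pow]; norm_num]
      ring
    refine ne_top_of_le_ne_top ?_ (ENNReal.tsum_le_tsum hle)
    exact (summable_geometric_two.mul_left _).tsum_ofReal_ne_top
  have := measure_setOfPred_frequently_eq_zero hsum
  filter_upwards [measure_eq_zero_iff_ae_notMem.1 this] with ω hω
  have hω' := not_frequently.1 hω
  filter_upwards [hω'] with n hn k hk
  refine not_lt.1 fun hlt => hn ?_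
  exact mem_iUnion₂.2 ⟨k, Finset.mem_range.2 hk, hlt⟩

theorem ae_dimH_pathGraph_le [IsProbabilityMeasure P] {S : ℝ≥0 → Ω → ℝ} {C h : ℝ} (hC : 0 ≤ C)
    (hh : h ∈ Ioo (0 : ℝ) 1) (hcont : ∀ᵐ ω ∂P, Continuous fun t => S t ω)
    (hlaw : ∀ t s : ℝ≥0, |(t : ℝ) - s| ≤ 1 → ∃ v : ℝ≥0,
      P.map (fun ω => S t ω - S s ω) = gaussianReal 0 v ∧ v ≤ C * |(t : ℝ) - s| ^ (2 * h)) :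
    ∀ᵐ ω ∂P, dimH (pathGraph fun t => S t ω) ≤ ENNReal.ofReal (2 - h) := by
  obtain ⟨u, -, hu, hulim⟩ := exists_seq_strictMono_tendsto' hh.1
  have h1 : ∀ᵐ ω ∂P, ∀ m T : ℕ, ∀ᶠ n : ℕ in atTop, ∀ k < T * 2 ^ n,
      |S ((k + 1 : ℕ) / 2 ^ n) ω - S ((k : ℕ) / 2 ^ n) ω| ≤ ((2 : ℝ) ^ (-u m)) ^ n :=
    ae_all_iff.2 fun m => ae_all_iff.2 fun T =>
      ae_eventually_dyadic_increments_le hC hlaw (hu m).2 T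
  filter_upwards [hcont, h1] with ω hω h1ω
  have hle : ∀ m, dimH (pathGraph fun t => S t ω) ≤ ENNReal.ofReal (2 - u m) := by
    intro m
    have hcover : pathGraph (fun t => S t ω) ⊆ ⋃ T : ℕ,
        (fun t : ℝ≥0 => (!₂[(t : ℝ), S t ω] : EuclideanSpace ℝ (Fin 2))) '' Iio (T : ℝ≥0) := by
      rintro _ ⟨t, rfl⟩
      obtain ⟨T, hT⟩ := exists_nat_gt t
      exact mem_iUnion.2 ⟨T, t, hT, rfl⟩
    refine (dimH_mono hcover).trans ?_
    rw [dimH_iUnion]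
    refine iSup_le fun T => ?_
    obtain ⟨n₀, hn₀⟩ := eventually_atTop.1 (h1ω m T)
    exact dimH_graph_Iio_le hω (hu m).1 ((hu m).2.trans hh.2) hn₀
  exact ge_of_tendsto' (ENNReal.tendsto_ofReal (hulim.const_sub 2)) hle

/-- A process with measurable marginals and almost surely continuous paths is indistinguishable from
one with genuinely measurable marginals and all paths continuous. The latter is jointly measurable,
as Tonelli's theorem requires. -/
theorem exists_measurable_continuous_modification {T : Type*} [TopologicalSpace T]
    [TopologicalSpace.SeparableSpace T]
    [FirstCountableTopology T] [Nonempty T] {S : T → Ω → ℝ}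
    (hm : ∀ t, AEMeasurable (S t) P) (hc : ∀ᵐ ω ∂P, Continuous fun t => S t ω) :
    ∃ Y : T → Ω → ℝ, (∀ t, Measurable (Y t)) ∧ (∀ ω, Continuous fun t => Y t ω) ∧
      ∀ᵐ ω ∂P, ∀ t, Y t ω = S t ω := by
  set d := TopologicalSpace.denseSeq T
  have hgood : ∀ᵐ ω ∂P, (Continuous fun t => S t ω) ∧ ∀ n, S (d n) ω = (hm (d n)).mk _ ω :=
    hc.and (ae_all_iff.2 fun n => (hm (d n)).ae_eq_mk)
  obtain ⟨G, hGsub, hGm, hGP⟩ := exists_measurable_superset_of_null hgood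
  have hG : ∀ ω ∉ G, (Continuous fun t => S t ω) ∧ ∀ n, S (d n) ω = (hm (d n)).mk _ ω :=
    fun ω hω => by
      by_contra h
      exact hω (hGsub h)
  refine ⟨fun t => Gᶜ.indicator (S t), fun t => ?_, fun ω => ?_, ?_⟩
  · have hdm : ∀ n, Measurable (Gᶜ.indicator (S (d n))) := fun n => by
      have : Gᶜ.indicator (S (d n)) = Gᶜ.indicator ((hm (d n)).mk _) :=
        indicator_congr fun ω hω => (hG ω hω).2 n
      rw [this]
      exact (hm (d n)).measurable_mk.indicator hGm.compl
    obtain ⟨x, hx, hxt⟩ := mem_closure_iff_seq_limit.1 (TopologicalSpace.denseRange_denseSeq T t)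
    choose n hn using hx
    refine measurable_of_tendsto_metrizable (f := fun k => Gᶜ.indicator (S (d (n k))))
      (fun k => hdm _) (tendsto_pi_nhds.2 fun ω => ?_)
    by_cases hω : ω ∈ G
    · simp [hω]
    · simp only [indicator_of_mem (show ω ∈ Gᶜ from hω)]
      have := ((hG ω hω).1.tendsto t).comp hxt
      refine this.congr fun k => ?_
      simp only [Function.comp, ← hn k]
      rfl
  · by_cases hω : ω ∈ G
    · simpa [hω] using continuous_const
    · simpa [indicator_of_mem (show ω ∈ Gᶜ from hω)] using (hG ω hω).1
  · filter_upwards [measure_eq_zero_iff_ae_notMem.1 hGP] with ω hω t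
    exact indicator_of_mem (show ω ∈ Gᶜ from hω) _

end

/-! ### Finite expected energy and the lower bound -/

theorem gaussianPDF_le (v : ℝ≥0) (x : ℝ) : gaussianPDF 0 v x ≤ ENNReal.ofReal (1 / √v) := by
  rw [gaussianPDF_def]
  refine ENNReal.ofReal_le_ofReal ?_
  rw [gaussianPDFReal_def]
  have h1 : Real.exp (-(x - 0) ^ 2 / (2 * v)) ≤ 1 := by
    rw [Real.exp_le_one_iff]
    exact div_nonpos_of_nonpos_of_nonneg (by nlinarith [sq_nonneg (x - 0)]) (by positivity)
  rcases eq_or_ne v 0 with rfl | hv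
  · simp
  have hv' : (0 : ℝ) < v := by positivity
  refine (mul_le_of_le_one_right (by positivity) h1).trans ?_
  rw [one_div]
  refine inv_anti₀ (by positivity) (Real.sqrt_le_sqrt ?_)
  nlinarith [Real.pi_gt_three]

/-- Bound the Gaussian density by `1 / √v` and substitute `x = τ y`. -/
theorem exists_lintegral_gaussianReal_rpow_le {σ : ℝ} (hσ : 1 < σ) :
    ∃ K : ℝ, 0 ≤ K ∧ ∀ (v : ℝ≥0) (τ : ℝ), v ≠ 0 → 0 < τ →
      ∫⁻ x, ENNReal.ofReal ((τ ^ 2 + x ^ 2) ^ (-σ / 2)) ∂gaussianReal 0 v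
        ≤ ENNReal.ofReal (K * τ ^ (1 - σ) / √v) := by
  have hint : Integrable (fun x : ℝ => (1 + x ^ 2) ^ (-σ / 2)) := by
    have := integrable_rpow_neg_one_add_norm_sq (E := ℝ) (μ := volume) (r := σ) (by simpa using hσ)
    simpa using this
  refine ⟨∫ x : ℝ, (1 + x ^ 2) ^ (-σ / 2), integral_nonneg fun x => by positivity,
    fun v τ hv hτ => ?_⟩
  have hscale : ∀ x : ℝ, (τ ^ 2 + x ^ 2) ^ (-σ / 2)
      = τ ^ (-σ) * (1 + (x / τ) ^ 2) ^ (-σ / 2) := by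
    intro x
    have : τ ^ 2 + x ^ 2 = τ ^ 2 * (1 + (x / τ) ^ 2) := by field_simp
    rw [this, Real.mul_rpow (by positivity) (by positivity), ← Real.rpow_natCast τ 2,
      ← Real.rpow_mul hτ.le]
    congr 2
    push_cast; ring
  have hint' : Integrable (fun x : ℝ => (τ ^ 2 + x ^ 2) ^ (-σ / 2)) := by
    simp_rw [hscale]
    exact (hint.comp_div hτ.ne').const_mul _
  rw [gaussianReal_of_var_ne_zero _ hv,
    lintegral_withDensity_eq_lintegral_mul _ (measurable_gaussianPDF 0 v) (by fun_prop)]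
  calc ∫⁻ x, (gaussianPDF 0 v * fun x => ENNReal.ofReal ((τ ^ 2 + x ^ 2) ^ (-σ / 2))) x
      ≤ ∫⁻ x, ENNReal.ofReal (1 / √v) * ENNReal.ofReal ((τ ^ 2 + x ^ 2) ^ (-σ / 2)) :=
        lintegral_mono fun x => mul_le_mul_left (gaussianPDF_le v x) _
    _ = ENNReal.ofReal (1 / √v) * ENNReal.ofReal (∫ x, (τ ^ 2 + x ^ 2) ^ (-σ / 2)) := by
        rw [lintegral_const_mul _ (by fun_prop), ofReal_integral_eq_lintegral_ofReal hint'
          (ae_of_all _ fun x => by positivity)]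
    _ = _ := by
        rw [← ENNReal.ofReal_mul (by positivity)]
        simp_rw [hscale]
        rw [integral_const_mul, Measure.integral_comp_div (fun y : ℝ => (1 + y ^ 2) ^ (-σ / 2)),
          abs_of_pos hτ, smul_eq_mul, sub_eq_add_neg, Real.rpow_add hτ, Real.rpow_one]
        congr 1
        ring

theorem exists_setLIntegral_abs_sub_rpow_le {β : ℝ} (hβ₁ : β < 1) :
    ∃ J : ℝ≥0∞, J ≠ ∞ ∧ ∀ t ∈ Icc (0 : ℝ) 1,
      ∫⁻ s in Icc (0 : ℝ) 1, ENNReal.ofReal (|t - s| ^ (-β)) ≤ J := by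
  set g : ℝ → ℝ≥0∞ := (Icc (0 : ℝ) 1).indicator fun x => ENNReal.ofReal (x ^ (-β)) with hg
  have hgm : Measurable g := Measurable.indicator (by fun_prop) measurableSet_Icc
  have hgfin : ∫⁻ x, g x ≠ ∞ := by
    have h1 := (intervalIntegrable_iff_integrableOn_Icc_of_le zero_le_one).1
      (intervalIntegral.intervalIntegrable_rpow' (a := 0) (b := 1) (r := -β) (by linarith))
    rw [hg, lintegral_indicator measurableSet_Icc]
    exact h1.lintegral_lt_top.ne
  refine ⟨(∫⁻ x, g x) + ∫⁻ x, g x, ENNReal.add_ne_top.2 ⟨hgfin, hgfin⟩, fun t ht => ?_⟩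
  calc ∫⁻ s in Icc (0 : ℝ) 1, ENNReal.ofReal (|t - s| ^ (-β))
      ≤ ∫⁻ s in Icc (0 : ℝ) 1, (g (t - s) + g (s - t)) := by
        refine setLIntegral_mono' measurableSet_Icc fun s hs => ?_
        rcases le_total s t with h | h
        · refine le_trans (le_of_eq ?_) le_self_add
          rw [hg, indicator_of_mem (mem_Icc.2 ⟨sub_nonneg.2 h, by linarith [ht.2, hs.1]⟩),
            abs_of_nonneg (sub_nonneg.2 h)]
        · refine le_trans (le_of_eq ?_) le_add_self
          rw [hg, indicator_of_mem (mem_Icc.2 ⟨sub_nonneg.2 h, by linarith [hs.2, ht.1]⟩),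
            abs_sub_comm, abs_of_nonneg (sub_nonneg.2 h)]
    _ ≤ ∫⁻ s, (g (t - s) + g (s - t)) := setLIntegral_le_lintegral _ _
    _ = _ := by
        rw [lintegral_add_left (by fun_prop), lintegral_sub_left_eq_self,
          lintegral_sub_right_eq_self]

theorem edist_graph_rpow (σ : ℝ) {t s : ℝ} (hts : t ≠ s) (x y : ℝ) :
    edist (!₂[t, x] : EuclideanSpace ℝ (Fin 2)) !₂[s, y] ^ (-σ)
      = ENNReal.ofReal ((|t - s| ^ 2 + (x - y) ^ 2) ^ (-σ / 2)) := by
  have hpos : 0 < |t - s| ^ 2 + (x - y) ^ 2 := by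
    have := abs_pos.2 (sub_ne_zero.2 hts)
    positivity
  have hd : dist (!₂[t, x] : EuclideanSpace ℝ (Fin 2)) !₂[s, y]
      = √(|t - s| ^ 2 + (x - y) ^ 2) := by
    rw [EuclideanSpace.dist_eq, Fin.sum_univ_two]
    simp [Real.dist_eq, sq_abs]
  rw [edist_dist, hd, ENNReal.ofReal_rpow_of_pos (Real.sqrt_pos.2 hpos), Real.sqrt_eq_rpow,
    ← Real.rpow_mul hpos.le]
  congr 2
  ring

section

variable {Ω : Type*} [MeasurableSpace Ω] {P : Measure Ω}

theorem measurable_graph_point {Y : ℝ≥0 → Ω → ℝ} (hm : ∀ t, Measurable (Y t))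
    (hc : ∀ ω, Continuous fun t => Y t ω) :
    Measurable fun p : Ω × ℝ => (!₂[p.2, Y p.2.toNNReal p.1] : EuclideanSpace ℝ (Fin 2)) := by
  have h1 := measurable_uncurry_of_continuous_of_measurable hc hm
  have h2 : Measurable fun p : Ω × ℝ => Y p.2.toNNReal p.1 :=
    h1.comp ((measurable_snd.real_toNNReal).prodMk measurable_fst)
  have h3 : Continuous fun q : ℝ × ℝ => (!₂[q.1, q.2] : EuclideanSpace ℝ (Fin 2)) := by fun_prop
  exact h3.measurable.comp (measurable_snd.prodMk h2)

/-- The expected `σ`-energy of Lebesgue measure on `[0, 1]` transported to the graph is finite for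
`1 < σ < 2 - h`. -/
theorem ae_le_dimH_pathGraph_of_lt [IsProbabilityMeasure P] {Y : ℝ≥0 → Ω → ℝ} {c h σ : ℝ}
    (hc₀ : 0 < c) (hσ₁ : 1 < σ) (hσ₂ : σ < 2 - h)
    (hm : ∀ t, Measurable (Y t)) (hc : ∀ ω, Continuous fun t => Y t ω)
    (hlaw : ∀ t s : ℝ≥0, ∃ v : ℝ≥0,
      P.map (fun ω => Y t ω - Y s ω) = gaussianReal 0 v ∧ c * |(t : ℝ) - s| ^ (2 * h) ≤ v) :
    ∀ᵐ ω ∂P, ENNReal.ofReal σ ≤ dimH (pathGraph fun t => Y t ω) := by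
  set γ : Ω → ℝ → EuclideanSpace ℝ (Fin 2) := fun ω t => !₂[t, Y t.toNNReal ω] with hγ
  have hγm : Measurable (Function.uncurry γ) := measurable_graph_point hm hc
  set l : Measure ℝ := volume.restrict (Icc (0 : ℝ) 1) with hl
  obtain ⟨K, hK₀, hK⟩ := exists_lintegral_gaussianReal_rpow_le hσ₁
  obtain ⟨J, hJ, hJle⟩ := exists_setLIntegral_abs_sub_rpow_le (β := σ + h - 1)
    (by linarith)
  have hF : Measurable fun q : (Ω × ℝ) × ℝ => edist (γ q.1.1 q.1.2) (γ q.1.1 q.2) ^ (-σ) :=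
    ((hγm.comp measurable_fst).edist
      (hγm.comp ((measurable_fst.comp measurable_fst).prodMk measurable_snd))).pow_const _
  have hexp : ∀ t ∈ Icc (0 : ℝ) 1, ∀ s ∈ Icc (0 : ℝ) 1, t ≠ s →
      ∫⁻ ω, edist (γ ω t) (γ ω s) ^ (-σ) ∂P
        ≤ ENNReal.ofReal (K / √c) * ENNReal.ofReal (|t - s| ^ (-(σ + h - 1))) := by
    intro t ht s hs hts
    have hτ : 0 < |t - s| := abs_pos.2 (sub_ne_zero.2 hts)
    obtain ⟨v, hv, hcv⟩ := hlaw t.toNNReal s.toNNReal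
    rw [Real.coe_toNNReal _ ht.1, Real.coe_toNNReal _ hs.1] at hcv
    have hvpos : (0 : ℝ) < v := lt_of_lt_of_le (by positivity) hcv
    have hsv : √c * |t - s| ^ h ≤ √v := by
      refine Real.le_sqrt_of_sq_le (le_trans (le_of_eq ?_) hcv)
      rw [mul_pow, Real.sq_sqrt hc₀.le, ← Real.rpow_natCast, ← Real.rpow_mul hτ.le]
      congr 2
      push_cast; ring
    calc ∫⁻ ω, edist (γ ω t) (γ ω s) ^ (-σ) ∂P
        = ∫⁻ ω, ENNReal.ofReal ((|t - s| ^ 2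
            + (Y t.toNNReal ω - Y s.toNNReal ω) ^ 2) ^ (-σ / 2)) ∂P :=
          lintegral_congr fun ω => edist_graph_rpow σ hts _ _
      _ = ∫⁻ x, ENNReal.ofReal ((|t - s| ^ 2 + x ^ 2) ^ (-σ / 2)) ∂gaussianReal 0 v := by
          rw [← hv, lintegral_map (by fun_prop) (by fun_prop)]
      _ ≤ ENNReal.ofReal (K * |t - s| ^ (1 - σ) / √v) := hK v _ (NNReal.coe_pos.1 hvpos).ne' hτ
      _ ≤ ENNReal.ofReal (K / √c * |t - s| ^ (-(σ + h - 1))) := by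
          refine ENNReal.ofReal_le_ofReal ?_
          calc K * |t - s| ^ (1 - σ) / √v ≤ K * |t - s| ^ (1 - σ) / (√c * |t - s| ^ h) := by
                gcongr
            _ = _ := by
                rw [show -(σ + h - 1) = (1 - σ) - h by ring, Real.rpow_sub hτ (1 - σ) h]
                field_simp
      _ = _ := ENNReal.ofReal_mul (by positivity)
  have hfin : ∫⁻ ω, ∫⁻ t, ∫⁻ s, edist (γ ω t) (γ ω s) ^ (-σ) ∂l ∂l ∂P ≠ ∞ := by
    have hswap : ∫⁻ ω, ∫⁻ t, ∫⁻ s, edist (γ ω t) (γ ω s) ^ (-σ) ∂l ∂l ∂P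
        = ∫⁻ t, ∫⁻ s, ∫⁻ ω, edist (γ ω t) (γ ω s) ^ (-σ) ∂P ∂l ∂l := by
      rw [lintegral_lintegral_swap]
      · refine lintegral_congr fun t => ?_
        rw [lintegral_lintegral_swap]
        exact (hF.comp ((measurable_fst.prodMk measurable_const).prodMk
          measurable_snd)).aemeasurable
      · exact hF.lintegral_prod_right'.aemeasurable
    rw [hswap]
    have hle : ∫⁻ t, ∫⁻ s, ∫⁻ ω, edist (γ ω t) (γ ω s) ^ (-σ) ∂P ∂l ∂l
        ≤ ∫⁻ _ : ℝ, ENNReal.ofReal (K / √c) * J ∂l := by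
      refine setLIntegral_mono' measurableSet_Icc fun t ht => ?_
      calc ∫⁻ s, ∫⁻ ω, edist (γ ω t) (γ ω s) ^ (-σ) ∂P ∂l
          ≤ ∫⁻ s, ENNReal.ofReal (K / √c)
              * ENNReal.ofReal (|t - s| ^ (-(σ + h - 1))) ∂l := by
            refine lintegral_mono_ae ?_
            have hne : ∀ᵐ s ∂l, s ≠ t := ae_restrict_of_ae (Measure.ae_ne volume t)
            filter_upwards [ae_restrict_mem measurableSet_Icc, hne] with s hs hst
            exact hexp t ht s hs hst.symm
        _ = ENNReal.ofReal (K / √c) * ∫⁻ s, ENNReal.ofReal (|t - s| ^ (-(σ + h - 1))) ∂l :=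
            lintegral_const_mul _ (by fun_prop)
        _ ≤ _ := by gcongr; exact hJle t ht
    refine ne_top_of_le_ne_top ?_ hle
    rw [lintegral_const, hl, Measure.restrict_apply_univ, Real.volume_Icc]
    exact ENNReal.mul_ne_top (ENNReal.mul_ne_top ENNReal.ofReal_ne_top hJ) ENNReal.ofReal_ne_top
  have hEm : Measurable fun ω => ∫⁻ t, ∫⁻ s, edist (γ ω t) (γ ω s) ^ (-σ) ∂l ∂l :=
    hF.lintegral_prod_right'.lintegral_prod_right'
  filter_upwards [ae_lt_top hEm hfin] with ω hω
  have hγω : Measurable (γ ω) := hγm.comp (measurable_const.prodMk measurable_id)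
  have hσ₀ : 0 < σ.toNNReal := Real.toNNReal_pos.2 (by linarith)
  refine le_dimH_of_lintegral_edist_rpow_ne_top (l.map (γ ω)) hσ₀ ?_ ?_
  · have h1 : l (Icc 0 1) ≤ l.map (γ ω) (pathGraph fun t => Y t ω) := by
      refine (measure_mono ?_).trans (Measure.le_map_apply hγω.aemeasurable _)
      intro t ht
      refine ⟨t.toNNReal, ?_⟩
      simp only [hγ, Real.coe_toNNReal _ ht.1]
    refine (lt_of_lt_of_le ?_ h1).ne'
    simp [hl]
  · rw [Real.coe_toNNReal _ (by linarith : 0 ≤ σ)]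
    rw [lintegral_map _ hγω]
    · have : ∀ t, ∫⁻ y, edist (γ ω t) y ^ (-σ) ∂l.map (γ ω)
          = ∫⁻ s, edist (γ ω t) (γ ω s) ^ (-σ) ∂l := fun t =>
        lintegral_map (by fun_prop) hγω
      simp_rw [this]
      exact hω.ne
    · exact Measurable.lintegral_prod_right'
        (f := fun q : EuclideanSpace ℝ (Fin 2) × EuclideanSpace ℝ (Fin 2) =>
          edist q.1 q.2 ^ (-σ)) (by fun_prop)

theorem ae_le_dimH_pathGraph [IsProbabilityMeasure P] {S : ℝ≥0 → Ω → ℝ} {c h : ℝ}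
    (hc₀ : 0 < c) (hh : h ∈ Ioo (0 : ℝ) 1) (hm : ∀ t, AEMeasurable (S t) P)
    (hc : ∀ᵐ ω ∂P, Continuous fun t => S t ω)
    (hlaw : ∀ t s : ℝ≥0, ∃ v : ℝ≥0,
      P.map (fun ω => S t ω - S s ω) = gaussianReal 0 v ∧ c * |(t : ℝ) - s| ^ (2 * h) ≤ v) :
    ∀ᵐ ω ∂P, ENNReal.ofReal (2 - h) ≤ dimH (pathGraph fun t => S t ω) := by
  obtain ⟨Y, hYm, hYc, hYS⟩ := exists_measurable_continuous_modification hm hc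
  have hYlaw : ∀ t s : ℝ≥0, ∃ v : ℝ≥0,
      P.map (fun ω => Y t ω - Y s ω) = gaussianReal 0 v ∧ c * |(t : ℝ) - s| ^ (2 * h) ≤ v := by
    intro t s
    obtain ⟨v, hv, hcv⟩ := hlaw t s
    refine ⟨v, ?_, hcv⟩
    rw [← hv]
    refine Measure.map_congr ?_
    filter_upwards [hYS] with ω hω
    rw [hω, hω]
  obtain ⟨u, -, hu, hulim⟩ := exists_seq_strictMono_tendsto' (show 1 < 2 - h by linarith [hh.2])
  have h1 : ∀ᵐ ω ∂P, ∀ n, ENNReal.ofReal (u n) ≤ dimH (pathGraph fun t => Y t ω) :=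
    ae_all_iff.2 fun n => ae_le_dimH_pathGraph_of_lt hc₀ (hu n).1 (hu n).2 hYm hYc hYlaw
  filter_upwards [h1, hYS] with ω hω hYω
  have : (fun t => S t ω) = fun t => Y t ω := funext fun t => (hYω t).symm
  rw [this]
  exact le_of_tendsto' (ENNReal.tendsto_ofReal hulim) hω

theorem IsMixedSubFractionalBM.ae_continuous {N : ℕ} {a H : Fin N → ℝ} {S : ℝ≥0 → Ω → ℝ}
    (hS : IsMixedSubFractionalBM a H S P) : ∀ᵐ ω ∂P, Continuous fun t => S t ω := by
  obtain ⟨ξ, hξ, -, hSξ⟩ := hS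
  choose B hB hξB using hξ
  filter_upwards [ae_all_iff.2 fun i => (hB i).continuous_paths] with ω hω
  simp_rw [hSξ, hξB]
  refine continuous_finsetSum _ fun i _ => ?_
  have h1 : Continuous fun t : ℝ≥0 => B i t ω := (hω i).comp NNReal.continuous_coe
  have h2 : Continuous fun t : ℝ≥0 => B i (-t) ω := (hω i).comp NNReal.continuous_coe.neg
  exact ((h1.add h2).div_const _).const_mul _

theorem IsMixedSubFractionalBM.aemeasurable {N : ℕ} {a H : Fin N → ℝ} {S : ℝ≥0 → Ω → ℝ}
    (hS : IsMixedSubFractionalBM a H S P) (t : ℝ≥0) : AEMeasurable (S t) P := by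
  obtain ⟨ξ, hξ, -, hSξ⟩ := hS
  choose B hB hξB using hξ
  have : S t = fun ω => ∑ i, a i * ((B i t ω + B i (-t) ω) / √2) :=
    funext fun ω => by simp_rw [hSξ, hξB]
  rw [this]
  have hm := fun i x => ((hB i).memLp x).aestronglyMeasurable.aemeasurable
  fun_prop

end

theorem lemma14 {Ω : Type*} [MeasurableSpace Ω] (P : Measure Ω) [IsProbabilityMeasure P]
    (N : ℕ) (a H : Fin N → ℝ) (ha : a ≠ 0) (hH : ∀ i, H i ∈ Set.Ioo (0 : ℝ) 1)
    (S : ℝ≥0 → Ω → ℝ) (hS : IsMixedSubFractionalBM a H S P)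
    (i₀ : Fin N) (hi₀ : IsLeast {h : ℝ | ∃ i, a i ≠ 0 ∧ h = H i} (H i₀)) :
    ∀ᵐ ω ∂P, dimH (pathGraph fun t => S t ω) = ENNReal.ofReal (2 - H i₀) := by
  obtain ⟨c, C, hc, hC, hlaw⟩ := hS.exists_map_sub_eq_gaussianReal hH hi₀
  have hcont := hS.ae_continuous
  have hle := ae_dimH_pathGraph_le hC.le (hH i₀) hcont fun t s hts => by
    obtain ⟨v, hv, -, hvC⟩ := hlaw t s
    exact ⟨v, hv, hvC hts⟩
  have hge := ae_le_dimH_pathGraph hc (hH i₀) hS.aemeasurable hcont fun t s => by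
    obtain ⟨v, hv, hcv, -⟩ := hlaw t s
    exact ⟨v, hv, hcv⟩
  filter_upwards [hle, hge] with ω h₁ h₂ using le_antisymm h₁ h₂
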